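/- Let $N\ge 1$. For $M\ge 0$ let $\mathrm{Pol}(O_M^+)$ be the universal unital complex $*$-algebra generated by self-adjoint elements $w_{kl}$ ($1\le k,l\le M$) such that the matrix $(w_{kl})$ is unitary. Let $\mathrm{Pol}(B_N^{+\sharp})$ be the universal unital complex $*$-algebra generated by self-adjoint elements $u_{ij}$ ($1\le i,j\le N$) such that $(u_{ij})$ is unitary and all row sums $\sum_k u_{ik}$ and all column sums $\sum_k u_{kj}$ are equal to one and the same element $s$. The algebra $\mathrm{Pol}(B_N^{+\prime})$ is defined in the same way with the additional relations $s\,u_{ij}=u_{ij}\,s$ for all $i,j$, and $\mathrm{Pol}(B_N^+)$ in the same way with the additional relation $s=1$. On each of these algebras let $\varepsilon$ be the character which sends the $(i,j)$ generator to $\delta_{ij}$. For a unital complex $*$-algebra $B$ with a character ($=$ unital $*$-homomorphism) $\varepsilon:B\to\mathbb C$ and a complex pre-Hilbert space $D$ (inner product linear in the second variable), a *Gaussian pair* with values in $D$ is a pair $(\phi,\eta)$ consisting of - a linear functional $\phi:B\to\mathbb C$ with $\phi(1)=0$, $\phi(b^*)=\overline{\phi(b)}$ for all $b$, $\phi(b^*b)\ge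 0$ for all $b\in\ker\varepsilon$, and $\phi(abc)=0$ for all $a,b,c\in\ker\varepsilon$; - a linear map $\eta:B\to D$ with $\eta(ab)=\varepsilon(a)\eta(b)+\eta(a)\varepsilon(b)$ for all $a,b$, such that $\phi(a^*b)-\varepsilon(a^*)\phi(b)-\phi(a^*)\varepsilon(b)=\langle\eta(a),\eta(b)\rangle$ for all $a,b\in B$. **Proposition.** The Gaussian pairs on $B_N^+$, $B_N^{+\prime}$ and $B_N^{+\sharp}$ are in natural one-to-one correspondence with the Gaussian pairs on $O_{N-1}^+$, in the following sense. There exist real $N\times(N-1)$ matrices $T$ whose columns form an orthonormal basis of $\{x\in\mathbb R^N:\sum_i x_i=0\}$, and for every such $T$ and every $\mathbb G\in\{B_N^+,B_N^{+\prime},B_N^{+\sharp}\}$ the formula $$q(u_{ij})=\frac1N\,1+\sum_{k,l=1}^{N-1}T_{ik}\,T_{jl}\,w_{kl}$$ defines a surjective unital $*$-homomorphism $q:\mathrm{Pol}(\mathbb G)\to\mathrm{Pol}(O_{N-1}^+)$ with $\varepsilon\circ q=\varepsilon$, which for $\mathbb G=B_N^+$ is an isomorphism; and for every complex pre-Hilbert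 space $D$ the map $(\phi,\eta)\mapsto(\phi\circ q,\eta\circ q)$ is a bijection from the set of Gaussian pairs on $\mathrm{Pol}(O_{N-1}^+)$ with values in $D$ onto the set of Gaussian pairs on $\mathrm{Pol}(\mathbb G)$ with values in $D$. -/

import Mathlib

universe u

/-! ## Universal unital complex `*`-algebras on self-adjoint generators

`FreeAlgebra ℂ X` carries in Mathlib the `ℂ`-linear word reversal as its star.  The involution
used here is the conjugate-linear one, `conjRev`, which fixes the generators. -/

noncomputable section

namespace GaussQG

open scoped ComplexOrder

/-- The conjugate-linear antimultiplicative map of the free complex algebra on `X` which fixes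
every generator: it reverses words and conjugates coefficients. -/
def conjRev (X : Type*) : FreeAlgebra ℂ X →+* (FreeAlgebra ℂ X)ᵐᵒᵖ :=
  (MonoidAlgebra.liftNCRingHom
      ((algebraMap ℂ (FreeAlgebra ℂ X)ᵐᵒᵖ).comp (starRingEnd ℂ))
      (FreeMonoid.lift fun x => MulOpposite.op (FreeAlgebra.ι ℂ x))
      (fun c _ => Algebra.commutes (starRingEnd ℂ c) _)).comp
    (FreeAlgebra.equivMonoidAlgebraFreeMonoid (R := ℂ) (X := X)).toRingEquiv.toRingHom

theorem conjRev_ι {X : Type*} (x : X) :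
    conjRev X (FreeAlgebra.ι ℂ x) = MulOpposite.op (FreeAlgebra.ι ℂ x) := by
  simp [conjRev, FreeAlgebra.equivMonoidAlgebraFreeMonoid, MonoidAlgebra.liftNCRingHom]

theorem conjRev_algebraMap {X : Type*} (c : ℂ) :
    conjRev X (algebraMap ℂ _ c) = MulOpposite.op (algebraMap ℂ _ (star c)) := by
  simp [conjRev, MonoidAlgebra.liftNCRingHom]

theorem conjRev_conjRev {X : Type*} (a : FreeAlgebra ℂ X) :
    (conjRev X (conjRev X a).unop).unop = a := by
  induction a using FreeAlgebra.induction with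
  | grade0 c => simp [conjRev_algebraMap]
  | grade1 x => simp [conjRev_ι]
  | mul a b ha hb => simp [ha, hb]
  | add a b ha hb => simp [ha, hb]

/-- The smallest star-invariant relation which contains `r`. -/
def starClosure {X : Type*} (r : FreeAlgebra ℂ X → FreeAlgebra ℂ X → Prop)
    (a b : FreeAlgebra ℂ X) : Prop :=
  r a b ∨ r (conjRev X a).unop (conjRev X b).unop

/-- The universal unital complex `*`-algebra generated by self-adjoint elements `x`, `x : X`,
subject to the relations `a = b` whenever `r a b`. -/
def UnivStarAlg {X : Type*} (r : FreeAlgebra ℂ X → FreeAlgebra ℂ X → Prop) : Type _ :=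
  RingQuot (starClosure r)

namespace UnivStarAlg

variable {X : Type*} (r : FreeAlgebra ℂ X → FreeAlgebra ℂ X → Prop)

instance : Ring (UnivStarAlg r) := inferInstanceAs (Ring (RingQuot (starClosure r)))

instance : Algebra ℂ (UnivStarAlg r) := inferInstanceAs (Algebra ℂ (RingQuot (starClosure r)))

/-- The quotient map from the free algebra. -/
def mk : FreeAlgebra ℂ X →ₐ[ℂ] UnivStarAlg r := RingQuot.mkAlgHom ℂ (starClosure r)

theorem mk_surjective : Function.Surjective (mk r) :=
  RingQuot.mkAlgHom_surjective ℂ (starClosure r)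

/-- The generator which corresponds to `x`. -/
def gen (x : X) : UnivStarAlg r := mk r (FreeAlgebra.ι ℂ x)

theorem mk_eq_of_starClosure {a b : FreeAlgebra ℂ X} (h : starClosure r a b) :
    mk r a = mk r b :=
  RingQuot.mkAlgHom_rel ℂ h

theorem mk_eq {a b : FreeAlgebra ℂ X} (h : r a b) : mk r a = mk r b :=
  mk_eq_of_starClosure r (Or.inl h)

/-- The involution, as a ring homomorphism to the opposite ring. -/
def starHom : UnivStarAlg r →+* (UnivStarAlg r)ᵐᵒᵖ :=
  RingQuot.lift ⟨(mk r).toRingHom.op.comp (conjRev X), fun a b h => by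
    have h' : starClosure r (conjRev X a).unop (conjRev X b).unop := by
      rcases h with h | h
      · right; rwa [conjRev_conjRev, conjRev_conjRev]
      · left; exact h
    have := mk_eq_of_starClosure r h'
    simpa using congrArg MulOpposite.op this⟩

theorem starHom_mk (a : FreeAlgebra ℂ X) :
    starHom r (mk r a) = MulOpposite.op (mk r (conjRev X a).unop) := by
  have h := RingQuot.mkAlgHom_coe ℂ (starClosure r)
  have h2 : mk r a = RingQuot.mkRingHom (starClosure r) a := by
    rw [← h]; rfl
  rw [h2]
  exact RingQuot.lift_mkRingHom_apply _ _ _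

instance : StarRing (UnivStarAlg r) where
  star a := (starHom r a).unop
  star_involutive a := by
    obtain ⟨a, rfl⟩ := mk_surjective r a
    change (starHom r (starHom r (mk r a)).unop).unop = mk r a
    simp [starHom_mk, conjRev_conjRev]
  star_mul a b := by
    change (starHom r (a * b)).unop = _
    simp
  star_add a b := by
    change (starHom r (a + b)).unop = _
    simp

theorem star_mk (a : FreeAlgebra ℂ X) : star (mk r a) = mk r (conjRev X a).unop := by
  change (starHom r (mk r a)).unop = _
  simp [starHom_mk]

theorem star_gen (x : X) : star (gen r x) = gen r x := by
  simp [gen, star_mk, conjRev_ι]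

instance : StarModule ℂ (UnivStarAlg r) where
  star_smul c a := by
    obtain ⟨a, rfl⟩ := mk_surjective r a
    rw [← map_smul, star_mk, star_mk, ← map_smul, Algebra.smul_def, Algebra.smul_def, map_mul,
      conjRev_algebraMap, MulOpposite.unop_mul, MulOpposite.unop_op, Algebra.commutes]

/-- Evaluation of the free algebra at self-adjoint elements respects the involutions. -/
theorem lift_conjRev {A : Type*} [Ring A] [StarRing A] [Algebra ℂ A] [StarModule ℂ A]
    (f : X → A) (hf : ∀ x, star (f x) = f x) (a : FreeAlgebra ℂ X) :
    FreeAlgebra.lift ℂ f (conjRev X a).unop = star (FreeAlgebra.lift ℂ f a) := by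
  induction a using FreeAlgebra.induction with
  | grade0 c =>
    rw [conjRev_algebraMap, MulOpposite.unop_op, AlgHom.commutes, AlgHom.commutes,
      algebraMap_star_comm]
  | grade1 x => simp [conjRev_ι, hf]
  | mul a b ha hb => simp [ha, hb]
  | add a b ha hb => simp [ha, hb]

/-- The universal property: self-adjoint elements `f x` of a `*`-algebra which satisfy the
relations define a unital `*`-homomorphism. -/
def lift {A : Type*} [Ring A] [StarRing A] [Algebra ℂ A] [StarModule ℂ A]
    (f : X → A) (hf : ∀ x, star (f x) = f x)
    (hr : ∀ a b, r a b → FreeAlgebra.lift ℂ f a = FreeAlgebra.lift ℂ f b) :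
    UnivStarAlg r →⋆ₐ[ℂ] A :=
  let g : UnivStarAlg r →ₐ[ℂ] A :=
    RingQuot.liftAlgHom ℂ ⟨FreeAlgebra.lift ℂ f, fun a b h => by
      rcases h with h | h
      · exact hr _ _ h
      · have := hr _ _ h
        rw [lift_conjRev f hf, lift_conjRev f hf] at this
        exact star_injective this⟩
  { g with
    map_star' := fun a => by
      have hg : ∀ b, g (mk r b) = FreeAlgebra.lift ℂ f b := fun b =>
        RingQuot.liftAlgHom_mkAlgHom_apply _ _ _ _
      obtain ⟨a, rfl⟩ := mk_surjective r a
      change g (star (mk r a)) = star (g (mk r a))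
      rw [star_mk, hg, hg, lift_conjRev f hf] }

theorem lift_gen {A : Type*} [Ring A] [StarRing A] [Algebra ℂ A] [StarModule ℂ A]
    (f : X → A) (hf : ∀ x, star (f x) = f x)
    (hr : ∀ a b, r a b → FreeAlgebra.lift ℂ f a = FreeAlgebra.lift ℂ f b) (x : X) :
    lift r f hf hr (gen r x) = f x :=
  (RingQuot.liftAlgHom_mkAlgHom_apply ℂ (FreeAlgebra.lift ℂ f) _ (FreeAlgebra.ι ℂ x)).trans
    (FreeAlgebra.lift_ι_apply f x)

end UnivStarAlg

/-! ## The quantum groups -/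

/-- The free generator `u i j` (before passing to the quotient). -/
abbrev fu {N : ℕ} (i j : Fin N) : FreeAlgebra ℂ (Fin N × Fin N) := FreeAlgebra.ι ℂ (i, j)

/-- The matrix `(u i j)` of self-adjoint elements is unitary. -/
inductive RelO (N : ℕ) : FreeAlgebra ℂ (Fin N × Fin N) → FreeAlgebra ℂ (Fin N × Fin N) → Prop
  | mul_star (i j : Fin N) : RelO N (∑ k, fu i k * fu j k) (if i = j then 1 else 0)
  | star_mul (i j : Fin N) : RelO N (∑ k, fu k i * fu k j) (if i = j then 1 else 0)

/-- Unitarity, and all row sums and column sums are equal to `1`. -/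
inductive RelB (N : ℕ) : FreeAlgebra ℂ (Fin N × Fin N) → FreeAlgebra ℂ (Fin N × Fin N) → Prop
  | orth {a b} (h : RelO N a b) : RelB N a b
  | row (i : Fin N) : RelB N (∑ k, fu i k) 1
  | col (j : Fin N) : RelB N (∑ k, fu k j) 1

/-- Unitarity, and all row sums and column sums are equal to each other. -/
inductive RelBSharp (N : ℕ) :
    FreeAlgebra ℂ (Fin N × Fin N) → FreeAlgebra ℂ (Fin N × Fin N) → Prop
  | orth {a b} (h : RelO N a b) : RelBSharp N a b
  | sums (i j : Fin N) : RelBSharp N (∑ k, fu i k) (∑ k, fu k j)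

/-- Unitarity, all row sums and column sums are equal to each other, and their common value
commutes with every generator. -/
inductive RelBPrime (N : ℕ) :
    FreeAlgebra ℂ (Fin N × Fin N) → FreeAlgebra ℂ (Fin N × Fin N) → Prop
  | orth {a b} (h : RelO N a b) : RelBPrime N a b
  | sums (i j : Fin N) : RelBPrime N (∑ k, fu i k) (∑ k, fu k j)
  | central (i j l : Fin N) :
      RelBPrime N (fu i j * ∑ k, fu l k) ((∑ k, fu l k) * fu i j)

/-- The `*`-algebra `Pol(O_N⁺)`. -/
abbrev PolO (N : ℕ) := UnivStarAlg (RelO N)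

/-- The `*`-algebra `Pol(B_N⁺)`. -/
abbrev PolB (N : ℕ) := UnivStarAlg (RelB N)

/-- The `*`-algebra `Pol(B_N⁺')`. -/
abbrev PolBPrime (N : ℕ) := UnivStarAlg (RelBPrime N)

/-- The `*`-algebra `Pol(B_N⁺♯)`. -/
abbrev PolBSharp (N : ℕ) := UnivStarAlg (RelBSharp N)

/-- The values `δ_{ij}` of the counit on the generators. -/
def delta (N : ℕ) (p : Fin N × Fin N) : ℂ := if p.1 = p.2 then 1 else 0

theorem star_delta {N : ℕ} (p : Fin N × Fin N) : star (delta N p) = delta N p := by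
  unfold delta; split_ifs <;> simp

theorem delta_relO {N : ℕ} {a b : FreeAlgebra ℂ (Fin N × Fin N)} (h : RelO N a b) :
    FreeAlgebra.lift ℂ (delta N) a = FreeAlgebra.lift ℂ (delta N) b := by
  cases h with
  | mul_star i j =>
    rw [apply_ite (FreeAlgebra.lift ℂ (delta N))]; simp [delta]
  | star_mul i j =>
    rw [apply_ite (FreeAlgebra.lift ℂ (delta N))]; simp [delta, eq_comm]

/-- The counit of `Pol(O_N⁺)`, `ε (u i j) = δ_{ij}`. -/
def counitO (N : ℕ) : PolO N →⋆ₐ[ℂ] ℂ :=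
  UnivStarAlg.lift (RelO N) (delta N) star_delta fun _ _ h => delta_relO h

/-- The counit of `Pol(B_N⁺)`, `ε (u i j) = δ_{ij}`. -/
def counitB (N : ℕ) : PolB N →⋆ₐ[ℂ] ℂ :=
  UnivStarAlg.lift (RelB N) (delta N) star_delta fun _ _ h => by
    cases h with
    | orth h => exact delta_relO h
    | row i => simp [delta]
    | col j => simp [delta]

/-- The counit of `Pol(B_N⁺')`, `ε (u i j) = δ_{ij}`. -/
def counitBPrime (N : ℕ) : PolBPrime N →⋆ₐ[ℂ] ℂ :=
  UnivStarAlg.lift (RelBPrime N) (delta N) star_delta fun _ _ h => by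
    cases h with
    | orth h => exact delta_relO h
    | sums i j => simp [delta]
    | central i j l => simp [delta]

/-- The counit of `Pol(B_N⁺♯)`, `ε (u i j) = δ_{ij}`. -/
def counitBSharp (N : ℕ) : PolBSharp N →⋆ₐ[ℂ] ℂ :=
  UnivStarAlg.lift (RelBSharp N) (delta N) star_delta fun _ _ h => by
    cases h with
    | orth h => exact delta_relO h
    | sums i j => simp [delta]

/-! ## Gaussian pairs on an augmented `*`-algebra `(B, ε)` -/

section Gaussian

variable {B : Type*} [Ring B] [StarRing B] [Algebra ℂ B] [StarModule ℂ B]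

/-- `K_n(B)`, the linear span of the products of `n` elements of the kernel of `ε`. -/
def kerPow (ε : B →⋆ₐ[ℂ] ℂ) (n : ℕ) : Submodule ℂ B :=
  Submodule.span ℂ
    {x | ∃ b : Fin n → B, (∀ i, ε (b i) = 0) ∧ x = (List.ofFn b).prod}

/-- Generating functionals: normalized, hermitian and conditionally positive functionals. -/
structure IsGeneratingFunctional (ε : B →⋆ₐ[ℂ] ℂ) (φ : B →ₗ[ℂ] ℂ) : Prop where
  map_one : φ 1 = 0
  hermitian : ∀ b, φ (star b) = star (φ b)
  cond_pos : ∀ b, ε b = 0 → 0 ≤ φ (star b * b)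

/-- Gaussian generating functionals: those which vanish on `K_3(B)`. -/
structure IsGaussianFunctional (ε : B →⋆ₐ[ℂ] ℂ) (φ : B →ₗ[ℂ] ℂ) : Prop
    extends IsGeneratingFunctional ε φ where
  map_kerPow_three : ∀ x ∈ kerPow ε 3, φ x = 0

/-- Gaussian cocycles, that is, `ε`-derivations with values in a vector space. -/
def IsGaussianCocycle {V : Type*} [AddCommGroup V] [Module ℂ V]
    (ε : B →⋆ₐ[ℂ] ℂ) (η : B →ₗ[ℂ] V) : Prop :=
  ∀ a b, η (a * b) = ε a • η b + ε b • η a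

/-- The coboundary of a functional, evaluated on the elementary tensor `a ⊗ b`. -/
def coboundary (ε : B →⋆ₐ[ℂ] ℂ) (ψ : B →ₗ[ℂ] ℂ) (a b : B) : ℂ :=
  ψ (a * b) - ε a * ψ b - ψ a * ε b

/-- The Gaussian pairs `(φ, η)` on `(B, ε)` whose cocycle takes values in the pre-Hilbert
space `D`. -/
def gaussianPairs (ε : B →⋆ₐ[ℂ] ℂ) (D : Type*) [NormedAddCommGroup D] [InnerProductSpace ℂ D] :
    Set ((B →ₗ[ℂ] ℂ) × (B →ₗ[ℂ] D)) :=
  {p | IsGaussianFunctional ε p.1 ∧ IsGaussianCocycle ε p.2 ∧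
    ∀ a b, coboundary ε p.1 (star a) b = inner ℂ (p.2 a) (p.2 b)}

variable {C : Type*} [Ring C] [StarRing C] [Algebra ℂ C] [StarModule ℂ C]

/-- `(φ, η) ↦ (φ ∘ q, η ∘ q)`. -/
def pullback (q : B →⋆ₐ[ℂ] C) (D : Type*) [NormedAddCommGroup D] [InnerProductSpace ℂ D]
    (p : (C →ₗ[ℂ] ℂ) × (C →ₗ[ℂ] D)) : (B →ₗ[ℂ] ℂ) × (B →ₗ[ℂ] D) :=
  (p.1 ∘ₗ q.toAlgHom.toLinearMap, p.2 ∘ₗ q.toAlgHom.toLinearMap)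

end Gaussian

/-- The columns of `T` form an orthonormal basis of the space of vectors in `ℝ^N` whose
coordinates have sum `0`. -/
structure IsSumZeroFrame {N : ℕ} (T : Matrix (Fin N) (Fin (N - 1)) ℝ) : Prop where
  orthonormal : T.transpose * T = 1
  sum_zero : ∀ k, ∑ i, T i k = 0

/-- The `(i, j)` entry of `(1/N) ξ ξᵗ + T w Tᵗ`, where `w` is the fundamental matrix of
`O_{N-1}⁺` and `ξ = (1, …, 1)`: the matrix which fixes `ξ` and acts as `w`, in the basis given
by `T`, on the orthogonal complement of `ξ`. -/
def blockEntry {N : ℕ} (T : Matrix (Fin N) (Fin (N - 1)) ℝ) (i j : Fin N) : PolO (N - 1) :=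
  algebraMap ℂ _ (1 / (N : ℂ)) +
    ∑ k, ∑ l, ((T i k * T j l : ℝ) : ℂ) • UnivStarAlg.gen (RelO (N - 1)) (k, l)

end GaussQG

end

noncomputable section

namespace GaussQG

open Matrix

/-! ## Real frames of the sum-zero hyperplane -/

/-! Let `ξ = (1, …, 1)` and let `U` be the matrix of generators, with common row and column sum `s`.
Summing a row of `U Uᵗ = 1` gives `s² = 1` (`sum_mul_self_eq_one`), so `x = s - 1` satisfies `x³ =
4x` and lies in `ker ε`. Hence `a x b = ¼ (a x) x (x b)` is a product of three elements of `ker ε`,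
and `φ` and `η` both vanish on it (`gaussianPairs_vanish`). Gaussian pairs therefore see only the
quotient where `s = 1`.

There `U` fixes `ξ`, so in an orthonormal basis adapted to `ξ` it is the block sum of `1` and an
orthogonal matrix `W` of size `N - 1`. `inflate` and `compress` are the two directions of this
change of basis.

No presentation of `ker q` is needed. In the quotient by `coreIdeal (φ, η)` the sums become `1`, so
the universal property of `Pol(O_{N-1}⁺)` factors the quotient map through `q`; thus `φ` and `η`
vanish on `ker q`. The same factorization of the identity map gives injectivity of `q` for `B_N⁺`.
Since the quotient by `coreIdeal` is used without an involution, orthogonality is expressed by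
transposes. -/

/-- The orthogonal projection of `ℝ^N` onto the line spanned by `(1, …, 1)`. -/
def meanProj (N : ℕ) : Matrix (Fin N) (Fin N) ℝ := Matrix.of fun _ _ => 1 / (N : ℝ)

theorem exists_isSumZeroFrame {N : ℕ} (hN : 1 ≤ N) :
    ∃ T : Matrix (Fin N) (Fin (N - 1)) ℝ, IsSumZeroFrame T := by
  let ξ : EuclideanSpace ℝ (Fin N) := WithLp.toLp 2 fun _ => 1
  have hξ : ξ ≠ 0 := by
    intro h
    have : ξ ⟨0, hN⟩ = 0 := by rw [h]; rfl
    simp [ξ] at this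
  have : Fact (Module.finrank ℝ (EuclideanSpace ℝ (Fin N)) = (N - 1) + 1) :=
    ⟨by rw [finrank_euclideanSpace_fin]; omega⟩
  let b := (stdOrthonormalBasis ℝ (ℝ ∙ ξ)ᗮ).reindex
    (finCongr (Submodule.finrank_orthogonal_span_singleton (n := N - 1) hξ))
  refine ⟨Matrix.of fun i k => (b k : EuclideanSpace ℝ (Fin N)) i, ?_, ?_⟩
  · ext k l
    have h := orthonormal_iff_ite.1 b.orthonormal k l
    rw [Submodule.coe_inner, PiLp.inner_apply] at h
    rw [Matrix.mul_apply, Matrix.one_apply, ← h]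
    exact Finset.sum_congr rfl fun i _ => mul_comm _ _
  · intro k
    have h := Submodule.mem_orthogonal_singleton_iff_inner_right.1 (b k).2
    simpa [ξ, PiLp.inner_apply] using h

namespace IsSumZeroFrame

variable {N : ℕ} {T : Matrix (Fin N) (Fin (N - 1)) ℝ}

/-- Bordering `T` with the unit column `ξ/√N` gives a square matrix with orthonormal columns. A
one-sided inverse of a square real matrix is two-sided, so its rows are orthonormal too. -/
theorem mul_transpose_add (hT : IsSumZeroFrame T) (hN : 1 ≤ N) :
    T * Tᵀ + meanProj N = 1 := by
  have hN0 : (N : ℝ) ≠ 0 := by exact_mod_cast (by omega : N ≠ 0)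
  let x : Matrix (Fin N) Unit ℝ := Matrix.of fun _ _ => 1 / Real.sqrt N
  have hs : (1 / Real.sqrt N) * (1 / Real.sqrt N) = 1 / (N : ℝ) := by
    rw [div_mul_div_comm, Real.mul_self_sqrt (by positivity), one_mul]
  have hTx : Tᵀ * x = 0 := by
    ext k u
    simp [Matrix.mul_apply, x, ← Finset.sum_mul, hT.sum_zero]
  have hxT : xᵀ * T = 0 := by
    rw [← Matrix.transpose_inj, Matrix.transpose_mul, Matrix.transpose_transpose, hTx]; simp
  have hxx : xᵀ * x = 1 := by
    ext u v
    simp only [Matrix.mul_apply, x, Matrix.transpose_apply, Matrix.of_apply, hs]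
    simp [hN0]
  have hP : x * xᵀ = meanProj N := by
    ext i j
    simp only [Matrix.mul_apply, x, Matrix.transpose_apply, Matrix.of_apply, hs, meanProj]
    simp
  let e : Fin N ≃ Fin (N - 1) ⊕ Unit := Fintype.equivOfCardEq (by simp; omega)
  have h := (Matrix.fromCols_mul_fromRows_eq_one_comm e T x Tᵀ xᵀ).2 (by
    rw [Matrix.fromRows_mul_fromCols, hT.orthonormal, hTx, hxT, hxx, Matrix.fromBlocks_one])
  rwa [Matrix.fromCols_mul_fromRows, hP] at h

theorem transpose_mul_meanProj (hT : IsSumZeroFrame T) : Tᵀ * meanProj N = 0 := by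
  ext k u
  simp [Matrix.mul_apply, meanProj, ← Finset.sum_mul, hT.sum_zero]

theorem meanProj_mul (hT : IsSumZeroFrame T) : meanProj N * T = 0 := by
  ext k u
  simp [Matrix.mul_apply, meanProj, ← Finset.mul_sum, hT.sum_zero]

end IsSumZeroFrame

/-! ## Orthogonal matrices over a complex algebra -/

section Matrices

variable {A : Type*} [Ring A] [Algebra ℂ A]

/-- Real scalars in a complex algebra. -/
def realScalar (A : Type*) [Ring A] [Algebra ℂ A] : ℝ →+* A :=
  (algebraMap ℂ A).comp Complex.ofRealHom

theorem realScalar_mul (x : ℝ) (a : A) : realScalar A x * a = (x : ℂ) • a := by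
  simp [realScalar, Algebra.smul_def]

theorem commute_realScalar (x : ℝ) (a : A) : realScalar A x * a = a * realScalar A x :=
  Algebra.commutes _ _

/-- A matrix over a ring with both `U * Uᵀ = 1` and `Uᵀ * U = 1`. -/
structure IsOrthogonal {n R : Type*} [Fintype n] [DecidableEq n] [Ring R]
    (U : Matrix n n R) : Prop where
  mul_transpose : U * Uᵀ = 1
  transpose_mul : Uᵀ * U = 1

/-- Transposition does not reverse products over a noncommutative ring; it does here because the
outer factors have central entries. -/
theorem transpose_conj {m n : Type*} [Fintype m] [Fintype n] (S : Matrix m n ℝ)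
    (W : Matrix n n A) :
    (S.map (realScalar A) * W * Sᵀ.map (realScalar A))ᵀ =
      S.map (realScalar A) * Wᵀ * Sᵀ.map (realScalar A) := by
  ext i j
  simp only [Matrix.transpose_apply, Matrix.mul_apply, Matrix.map_apply, Finset.sum_mul]
  rw [Finset.sum_comm]
  refine Finset.sum_congr rfl fun k _ => Finset.sum_congr rfl fun l _ => ?_
  rw [mul_assoc, ← commute_realScalar (S i l), commute_realScalar (S j k)]

variable {N : ℕ}

/-- The matrix `(1/N) ξ ξᵗ + T W Tᵗ`. -/
def inflate (T : Matrix (Fin N) (Fin (N - 1)) ℝ) (W : Matrix (Fin (N - 1)) (Fin (N - 1)) A) :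
    Matrix (Fin N) (Fin N) A :=
  (meanProj N).map (realScalar A) + T.map (realScalar A) * W * Tᵀ.map (realScalar A)

/-- The matrix `Tᵗ U T`. -/
def compress (T : Matrix (Fin N) (Fin (N - 1)) ℝ) (U : Matrix (Fin N) (Fin N) A) :
    Matrix (Fin (N - 1)) (Fin (N - 1)) A :=
  Tᵀ.map (realScalar A) * U * T.map (realScalar A)

variable (T : Matrix (Fin N) (Fin (N - 1)) ℝ)

theorem inflate_apply (W : Matrix (Fin (N - 1)) (Fin (N - 1)) A) (i j : Fin N) :
    inflate T W i j = algebraMap ℂ A (1 / (N : ℂ)) +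
      ∑ k, ∑ l, ((T i k * T j l : ℝ) : ℂ) • W k l := by
  simp only [inflate, Matrix.add_apply, Matrix.mul_apply, Matrix.map_apply,
    Matrix.transpose_apply, Finset.sum_mul]
  congr 1
  · simp [meanProj, realScalar]
  · rw [Finset.sum_comm]
    refine Finset.sum_congr rfl fun k _ => Finset.sum_congr rfl fun l _ => ?_
    rw [← commute_realScalar, ← mul_assoc, ← map_mul, realScalar_mul, mul_comm]

theorem compress_apply (U : Matrix (Fin N) (Fin N) A) (k l : Fin (N - 1)) :
    compress T U k l = ∑ i, ∑ j, ((T i k * T j l : ℝ) : ℂ) • U i j := by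
  simp only [compress, Matrix.mul_apply, Matrix.map_apply,
    Matrix.transpose_apply, Finset.sum_mul]
  rw [Finset.sum_comm]
  refine Finset.sum_congr rfl fun i _ => Finset.sum_congr rfl fun j _ => ?_
  rw [← commute_realScalar, ← mul_assoc, ← map_mul, realScalar_mul, mul_comm]

theorem transpose_inflate (W : Matrix (Fin (N - 1)) (Fin (N - 1)) A) :
    (inflate T W)ᵀ = inflate T Wᵀ := by
  rw [inflate, Matrix.transpose_add, transpose_conj]; rfl

theorem transpose_compress (U : Matrix (Fin N) (Fin N) A) :
    (compress T U)ᵀ = compress T Uᵀ := by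
  simpa [compress] using transpose_conj Tᵀ U

/-- `U` fixes the vector `(1, …, 1)`. -/
def RowSumsOne (U : Matrix (Fin N) (Fin N) A) : Prop := ∀ i, ∑ k, U i k = 1

variable {T}

theorem map_mul_eq {l m n : Type*} [Fintype m] {X : Matrix l m ℝ} {Y : Matrix m n ℝ}
    {Z : Matrix l n ℝ} (h : X * Y = Z) :
    X.map (realScalar A) * Y.map (realScalar A) = Z.map (realScalar A) := by
  rw [← Matrix.map_mul, h]

theorem RowSumsOne.mul_meanProj {U : Matrix (Fin N) (Fin N) A} (h : RowSumsOne U) :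
    U * (meanProj N).map (realScalar A) = (meanProj N).map (realScalar A) := by
  ext i j
  simp [Matrix.mul_apply, meanProj, ← Finset.sum_mul, h i]

theorem RowSumsOne.meanProj_mul {U : Matrix (Fin N) (Fin N) A} (h : RowSumsOne Uᵀ) :
    (meanProj N).map (realScalar A) * U = (meanProj N).map (realScalar A) := by
  ext i j
  have := h j
  simp only [Matrix.transpose_apply] at this
  simp [Matrix.mul_apply, meanProj, ← Finset.mul_sum, this]

/-! ### Passing between `W` and the block matrix `(1/N) ξ ξᵗ + T W Tᵗ`. -/

namespace IsSumZeroFrame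

theorem map_transpose_mul (hT : IsSumZeroFrame T) :
    Tᵀ.map (realScalar A) * T.map (realScalar A) = 1 := by
  rw [map_mul_eq hT.orthonormal]; simp

theorem map_mul_transpose (hT : IsSumZeroFrame T) (hN : 1 ≤ N) :
    T.map (realScalar A) * Tᵀ.map (realScalar A) = 1 - (meanProj N).map (realScalar A) := by
  rw [map_mul_eq (eq_sub_of_add_eq (hT.mul_transpose_add hN)),
    Matrix.map_sub _ (map_sub (realScalar A))]
  simp

theorem map_transpose_mul_meanProj (hT : IsSumZeroFrame T) :
    Tᵀ.map (realScalar A) * (meanProj N).map (realScalar A) = 0 := by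
  rw [map_mul_eq hT.transpose_mul_meanProj]; simp

theorem map_meanProj_mul (hT : IsSumZeroFrame T) :
    (meanProj N).map (realScalar A) * T.map (realScalar A) = 0 := by
  rw [map_mul_eq hT.meanProj_mul]; simp

theorem map_meanProj_mul_meanProj (hN : 1 ≤ N) :
    (meanProj N).map (realScalar A) * (meanProj N).map (realScalar A) =
      (meanProj N).map (realScalar A) := by
  refine map_mul_eq ?_
  have hN0 : (N : ℝ) ≠ 0 := by exact_mod_cast (by omega : N ≠ 0)
  ext i j
  simp [Matrix.mul_apply, meanProj, hN0]

/-- The two blocks act on orthogonal subspaces, so the mixed terms vanish and `Tᵗ T = 1` joins the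
rest. Multiplicativity is what transports orthogonality from `W` to the block matrix. -/
theorem inflate_mul_inflate (hT : IsSumZeroFrame T) (hN : 1 ≤ N)
    (W W' : Matrix (Fin (N - 1)) (Fin (N - 1)) A) :
    inflate T W * inflate T W' = inflate T (W * W') := by
  have e1 : (meanProj N).map (realScalar A) *
      (T.map (realScalar A) * W' * Tᵀ.map (realScalar A)) = 0 := by
    simp [← Matrix.mul_assoc, hT.map_meanProj_mul]
  have e2 : T.map (realScalar A) * W * Tᵀ.map (realScalar A) *
      (meanProj N).map (realScalar A) = 0 := by
    simp [Matrix.mul_assoc, hT.map_transpose_mul_meanProj]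
  have e3 : T.map (realScalar A) * W * Tᵀ.map (realScalar A) *
      (T.map (realScalar A) * W' * Tᵀ.map (realScalar A)) =
      T.map (realScalar A) * (W * W') * Tᵀ.map (realScalar A) := by
    calc _ = T.map (realScalar A) * W * (Tᵀ.map (realScalar A) * T.map (realScalar A)) *
          W' * Tᵀ.map (realScalar A) := by simp only [Matrix.mul_assoc]
      _ = _ := by rw [hT.map_transpose_mul]; simp only [Matrix.mul_assoc, Matrix.one_mul]
  simp only [inflate, add_mul, mul_add, e1, e2, e3, map_meanProj_mul_meanProj hN]
  simp

theorem inflate_one (hT : IsSumZeroFrame T) (hN : 1 ≤ N) :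
    inflate T (1 : Matrix (Fin (N - 1)) (Fin (N - 1)) A) = 1 := by
  rw [inflate, Matrix.mul_one, hT.map_mul_transpose hN]; abel

theorem compress_inflate (hT : IsSumZeroFrame T) (W : Matrix (Fin (N - 1)) (Fin (N - 1)) A) :
    compress T (inflate T W) = W := by
  calc compress T (inflate T W)
      = Tᵀ.map (realScalar A) * (meanProj N).map (realScalar A) * T.map (realScalar A) +
        (Tᵀ.map (realScalar A) * T.map (realScalar A)) * W *
          (Tᵀ.map (realScalar A) * T.map (realScalar A)) := by
        simp only [compress, inflate, Matrix.mul_add, Matrix.add_mul, Matrix.mul_assoc]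
    _ = W := by rw [hT.map_transpose_mul, hT.map_transpose_mul_meanProj]; simp

theorem isOrthogonal_inflate (hT : IsSumZeroFrame T) (hN : 1 ≤ N)
    {W : Matrix (Fin (N - 1)) (Fin (N - 1)) A} (hW : IsOrthogonal W) :
    IsOrthogonal (inflate T W) where
  mul_transpose := by
    rw [transpose_inflate, hT.inflate_mul_inflate hN, hW.mul_transpose, hT.inflate_one hN]
  transpose_mul := by
    rw [transpose_inflate, hT.inflate_mul_inflate hN, hW.transpose_mul, hT.inflate_one hN]

theorem rowSumsOne_inflate (hT : IsSumZeroFrame T) (hN : 1 ≤ N)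
    (W : Matrix (Fin (N - 1)) (Fin (N - 1)) A) : RowSumsOne (inflate T W) := by
  intro i
  have hN0 : (N : ℂ) ≠ 0 := by exact_mod_cast (by omega : N ≠ 0)
  simp only [inflate_apply, Finset.sum_add_distrib]
  rw [Finset.sum_comm]
  have h : ∀ k, ∑ j, ∑ l, ((T i k * T j l : ℝ) : ℂ) • W k l = 0 := by
    intro k
    rw [Finset.sum_comm]
    refine Finset.sum_eq_zero fun l _ => ?_
    rw [← Finset.sum_smul, ← Complex.ofReal_sum, ← Finset.mul_sum, hT.sum_zero]
    simp
  simp only [h, Finset.sum_const_zero, add_zero, Finset.sum_const, Finset.card_univ,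
    Fintype.card_fin, ← map_nsmul]
  simp [hN0]

/-- With `P` the projection onto `ξ`, the inner factor is `T Tᵗ = 1 - P`. The correction term `U P
V` equals `P`, which `Tᵗ` annihilates. Keeping `V` separate covers both `U Uᵗ` and `Uᵗ U`. -/
theorem compress_mul_compress (hT : IsSumZeroFrame T) (hN : 1 ≤ N)
    {U V : Matrix (Fin N) (Fin N) A} (hU : RowSumsOne U) (hUV : U * V = 1) (hV : RowSumsOne Vᵀ) :
    compress T U * compress T V = 1 := by
  calc compress T U * compress T V
      = Tᵀ.map (realScalar A) * (U * (T.map (realScalar A) * Tᵀ.map (realScalar A)) * V) *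
          T.map (realScalar A) := by simp only [compress, Matrix.mul_assoc]
    _ = 1 := by
      rw [hT.map_mul_transpose hN, mul_sub, sub_mul, hU.mul_meanProj, hV.meanProj_mul,
        Matrix.mul_one, hUV, Matrix.mul_sub, hT.map_transpose_mul_meanProj, sub_zero,
        Matrix.mul_one, hT.map_transpose_mul]

theorem isOrthogonal_compress (hT : IsSumZeroFrame T) (hN : 1 ≤ N)
    {U : Matrix (Fin N) (Fin N) A} (hU : IsOrthogonal U) (hr : RowSumsOne U)
    (hc : RowSumsOne Uᵀ) : IsOrthogonal (compress T U) where
  mul_transpose := by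
    rw [transpose_compress]
    exact hT.compress_mul_compress hN hr hU.mul_transpose hr
  transpose_mul := by
    rw [transpose_compress]
    exact hT.compress_mul_compress hN hc hU.transpose_mul hc

/-- Since `P U = U P = P`, the compression `(1 - P) U (1 - P)` is `U - P`, and `inflate` adds `P`
back. -/
theorem inflate_compress (hT : IsSumZeroFrame T) (hN : 1 ≤ N)
    {U : Matrix (Fin N) (Fin N) A} (hr : RowSumsOne U) (hc : RowSumsOne Uᵀ) :
    inflate T (compress T U) = U := by
  calc inflate T (compress T U)
      = (meanProj N).map (realScalar A) + (T.map (realScalar A) * Tᵀ.map (realScalar A)) * U *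
          (T.map (realScalar A) * Tᵀ.map (realScalar A)) := by
        simp only [inflate, compress, Matrix.mul_assoc]
    _ = U := by
      rw [hT.map_mul_transpose hN, sub_mul, hc.meanProj_mul, mul_sub, Matrix.one_mul, sub_mul,
        sub_mul, map_meanProj_mul_meanProj hN, hr.mul_meanProj]
      simp

end IsSumZeroFrame

end Matrices

/-! ## Homomorphisms out of the universal algebras -/

namespace UnivStarAlg

variable {X : Type*} {r : FreeAlgebra ℂ X → FreeAlgebra ℂ X → Prop}

theorem algHom_ext {A : Type*} [Ring A] [Algebra ℂ A] {f g : UnivStarAlg r →ₐ[ℂ] A}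
    (h : ∀ x, f (gen r x) = g (gen r x)) : f = g := by
  have hc : f.comp (mk r) = g.comp (mk r) := FreeAlgebra.hom_ext (funext h)
  ext b
  obtain ⟨a, rfl⟩ := mk_surjective r b
  exact DFunLike.congr_fun hc a

end UnivStarAlg

/-- The target needs no involution: reversing words turns the relation indexed by `(i, j)` into the
one indexed by `(j, i)`, so the star closure imposes nothing new. -/
theorem exists_algHom_polO {M : ℕ} {A : Type*} [Ring A] [Algebra ℂ A]
    {W : Matrix (Fin M) (Fin M) A} (hW : IsOrthogonal W) :
    ∃ p : PolO M →ₐ[ℂ] A, ∀ k l, p (UnivStarAlg.gen (RelO M) (k, l)) = W k l := by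
  let f : FreeAlgebra ℂ (Fin M × Fin M) →ₐ[ℂ] A := FreeAlgebra.lift ℂ fun x => W x.1 x.2
  have hmul : ∀ i j, ∑ k, W i k * W j k = if i = j then 1 else 0 := fun i j => by
    have := congrFun (congrFun hW.mul_transpose i) j
    simpa [Matrix.mul_apply, Matrix.one_apply] using this
  have hmul' : ∀ i j, ∑ k, W k i * W k j = if i = j then 1 else 0 := fun i j => by
    have := congrFun (congrFun hW.transpose_mul i) j
    simpa [Matrix.mul_apply, Matrix.one_apply] using this
  have h1 : ∀ a b, RelO M a b → f a = f b := by
    intro a b h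
    cases h with
    | mul_star i j => rw [apply_ite f]; simpa [f] using hmul i j
    | star_mul i j => rw [apply_ite f]; simpa [f] using hmul' i j
  have h2 : ∀ a b, RelO M a b → f (conjRev _ a).unop = f (conjRev _ b).unop := by
    intro a b h
    cases h with
    | mul_star i j =>
      rw [apply_ite (conjRev _), apply_ite MulOpposite.unop, apply_ite f]
      simpa [f, conjRev_ι, eq_comm] using hmul j i
    | star_mul i j =>
      rw [apply_ite (conjRev _), apply_ite MulOpposite.unop, apply_ite f]
      simpa [f, conjRev_ι, eq_comm] using hmul' j i
  have h3 : ∀ ⦃a b⦄, starClosure (RelO M) a b → f a = f b := by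
    rintro a b (h | h)
    · exact h1 a b h
    · have := h2 _ _ h
      rwa [conjRev_conjRev, conjRev_conjRev] at this
  refine ⟨RingQuot.liftAlgHom ℂ ⟨f, h3⟩, fun k l => ?_⟩
  exact (RingQuot.liftAlgHom_mkAlgHom_apply ℂ f h3 (FreeAlgebra.ι ℂ (k, l))).trans
    (FreeAlgebra.lift_ι_apply _ _)

/-- The matrix of the generators. -/
def genMatrix {N : ℕ}
    (r : FreeAlgebra ℂ (Fin N × Fin N) → FreeAlgebra ℂ (Fin N × Fin N) → Prop) :
    Matrix (Fin N) (Fin N) (UnivStarAlg r) :=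
  Matrix.of fun i j => UnivStarAlg.gen r (i, j)

theorem isOrthogonal_genMatrix {N : ℕ}
    {r : FreeAlgebra ℂ (Fin N × Fin N) → FreeAlgebra ℂ (Fin N × Fin N) → Prop}
    (hr : ∀ a b, RelO N a b → r a b) : IsOrthogonal (genMatrix r) where
  mul_transpose := by
    ext i j
    have h := UnivStarAlg.mk_eq r (hr _ _ (RelO.mul_star i j))
    rw [apply_ite (UnivStarAlg.mk r)] at h
    simpa [Matrix.mul_apply, Matrix.one_apply, genMatrix, UnivStarAlg.gen] using h
  transpose_mul := by
    ext i j
    have h := UnivStarAlg.mk_eq r (hr _ _ (RelO.star_mul i j))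
    rw [apply_ite (UnivStarAlg.mk r)] at h
    simpa [Matrix.mul_apply, Matrix.one_apply, genMatrix, UnivStarAlg.gen] using h

theorem IsOrthogonal.map {A B n : Type*} [Fintype n] [DecidableEq n] [Ring A] [Ring B]
    {U : Matrix n n A} (hU : IsOrthogonal U) (f : A →+* B) : IsOrthogonal (U.map f) where
  mul_transpose := by
    rw [← Matrix.transpose_map, ← Matrix.map_mul, hU.mul_transpose]; simp
  transpose_mul := by
    rw [← Matrix.transpose_map, ← Matrix.map_mul, hU.transpose_mul]; simp

variable {N : ℕ}

theorem blockEntry_eq_inflate (T : Matrix (Fin N) (Fin (N - 1)) ℝ) (i j : Fin N) :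
    blockEntry T i j = inflate T (genMatrix (RelO (N - 1))) i j := by
  rw [inflate_apply]; rfl

theorem star_blockEntry (T : Matrix (Fin N) (Fin (N - 1)) ℝ) (i j : Fin N) :
    star (blockEntry T i j) = blockEntry T i j := by
  simp only [blockEntry, star_add, star_sum, star_smul, UnivStarAlg.star_gen,
    ← algebraMap_star_comm]
  simp

/-- The counit sends `w` to the identity matrix, and inflating the identity gives the identity. -/
theorem counitO_blockEntry {T : Matrix (Fin N) (Fin (N - 1)) ℝ} (hT : IsSumZeroFrame T)
    (hN : 1 ≤ N) (i j : Fin N) :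
    counitO (N - 1) (blockEntry T i j) = delta N (i, j) := by
  have h := congrFun (congrFun (hT.inflate_one (A := ℂ) hN) i) j
  rw [inflate_apply] at h
  have hg : ∀ k l, counitO (N - 1) (UnivStarAlg.gen (RelO (N - 1)) (k, l)) =
      (1 : Matrix (Fin (N - 1)) (Fin (N - 1)) ℂ) k l := fun k l =>
    (UnivStarAlg.lift_gen _ _ _ _ _).trans (by simp [delta, Matrix.one_apply])
  simp only [blockEntry, map_add, map_sum, map_smul, hg]
  rw [show delta N (i, j) = (1 : Matrix (Fin N) (Fin N) ℂ) i j by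
    simp [delta, Matrix.one_apply], ← h]
  congr 1
  exact AlgHomClass.commutes _ _

/-- If `U` is an orthogonal matrix whose row and column sums are mapped to `1` by `π`, then
`Pol(O_{N-1}⁺)` maps to the target of `π` so that the block matrix goes to the image of `U`. -/
theorem exists_algHom_polO_blockEntry {B A : Type*} [Ring B] [Algebra ℂ B] [Ring A] [Algebra ℂ A]
    {T : Matrix (Fin N) (Fin (N - 1)) ℝ} (hT : IsSumZeroFrame T) (hN : 1 ≤ N)
    {U : Matrix (Fin N) (Fin N) B} (hU : IsOrthogonal U) (π : B →ₐ[ℂ] A)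
    (hr : ∀ i, π (∑ k, U i k) = 1) (hc : ∀ j, π (∑ k, U k j) = 1) :
    ∃ p : PolO (N - 1) →ₐ[ℂ] A, ∀ i j, p (blockEntry T i j) = π (U i j) := by
  have hr' : RowSumsOne (U.map π) := fun i => by simpa using hr i
  have hc' : RowSumsOne (U.map π)ᵀ := fun j => by simpa using hc j
  have hU' : IsOrthogonal (U.map π) := hU.map (π : B →+* A)
  obtain ⟨p, hp⟩ := exists_algHom_polO (hT.isOrthogonal_compress hN hU' hr' hc')
  refine ⟨p, fun i j => ?_⟩
  have h := congrFun (congrFun (hT.inflate_compress hN hr' hc') i) j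
  rw [inflate_apply, Matrix.map_apply] at h
  rw [← h, blockEntry]
  simp only [map_add, map_sum, map_smul, hp, AlgHom.commutes]

/-! ## Gaussian pairs -/

/-- The largest two-sided ideal on which the linear map `f` vanishes. -/
def coreIdeal {B V : Type*} [Ring B] [Algebra ℂ B] [AddCommGroup V] [Module ℂ V]
    (f : B →ₗ[ℂ] V) : TwoSidedIdeal B :=
  TwoSidedIdeal.mk' {x | ∀ a b, f (a * x * b) = 0}
    (by simp)
    (fun {x y} hx hy a b => by rw [mul_add, add_mul, map_add, hx, hy, add_zero])
    (fun {x} hx a b => by rw [mul_neg, neg_mul, map_neg, hx, neg_zero])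
    (fun {x y} hy a b => by rw [← mul_assoc a]; exact hy _ _)
    (fun {x y} hx a b => by rw [← mul_assoc a, mul_assoc _ y]; exact hx _ _)

/-- Used in both directions: to see that `s - 1` dies in the quotient, and to return from the
quotient to the vanishing of `f`. -/
theorem mk_coreIdeal_eq_zero_iff {B V : Type*} [Ring B] [Algebra ℂ B] [AddCommGroup V]
    [Module ℂ V] (f : B →ₗ[ℂ] V) (x : B) :
    (coreIdeal f).ringCon.mkₐ (α := ℂ) x = 0 ↔ ∀ a b, f (a * x * b) = 0 := by
  have h1 : (coreIdeal f).ringCon.mkₐ (α := ℂ) x = 0 ↔ x ∈ coreIdeal f := by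
    rw [TwoSidedIdeal.mem_iff, ← map_zero ((coreIdeal f).ringCon.mkₐ (α := ℂ))]
    exact RingCon.eq _
  rw [h1]
  exact TwoSidedIdeal.mem_mk' _ _ _ _ _ _ x

section

variable {B : Type*} [Ring B] [StarRing B] [Algebra ℂ B]
  {C : Type*} [Ring C] [StarRing C] [Algebra ℂ C]
  {D : Type*} [NormedAddCommGroup D] [InnerProductSpace ℂ D]

/-- Gaussian pairs vanish on the ideal generated by `s - 1` when `s² = 1` and `ε s = 1`. -/
theorem gaussianPairs_vanish {ε : B →⋆ₐ[ℂ] ℂ} {p : (B →ₗ[ℂ] ℂ) × (B →ₗ[ℂ] D)}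
    (hp : p ∈ gaussianPairs ε D) {s : B} (hs : s * s = 1) (hε : ε s = 1) (a b : B) :
    p.1 (a * (s - 1) * b) = 0 ∧ p.2 (a * (s - 1) * b) = 0 := by
  have h0 : ε (s - 1) = 0 := by rw [map_sub, hε, map_one, sub_self]
  -- From `s² = 1`, `x = s - 1` satisfies `x² = -2x`, hence `x³ = 4x`; this is the source of the
  -- factor `1/4`.
  have hsq : (s - 1) * (s - 1) = (-2 : ℂ) • (s - 1) := by
    rw [mul_sub, sub_mul, hs, mul_one, one_mul, neg_smul, two_smul]; abel
  have hcube : (s - 1) * (s - 1) * (s - 1) = (4 : ℂ) • (s - 1) := by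
    rw [hsq, smul_mul_assoc, hsq, smul_smul]; norm_num
  have key : a * (s - 1) * b =
      (1 / 4 : ℂ) • ((a * (s - 1)) * (s - 1) * ((s - 1) * b)) := by
    have : (a * (s - 1)) * (s - 1) * ((s - 1) * b) =
        a * ((s - 1) * (s - 1) * (s - 1)) * b := by simp only [mul_assoc]
    rw [this, hcube, mul_smul_comm, smul_mul_assoc, smul_smul]; norm_num
  rw [key, map_smul, map_smul]
  constructor
  · rw [hp.1.map_kerPow_three _ (Submodule.subset_span
      ⟨![a * (s - 1), s - 1, (s - 1) * b], ?_, by simp [List.ofFn_succ, mul_assoc]⟩), smul_zero]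
    intro i
    fin_cases i <;> simp [hε]
  -- The derivation rule kills a product of two elements of `ker ε`, here `a x x` and `x b`.
  · rw [hp.2.1]
    simp [hε]

/-! ### Transport of Gaussian pairs along a surjection compatible with the characters. -/

theorem kerPow_map {ε : B →⋆ₐ[ℂ] ℂ} {ε' : C →⋆ₐ[ℂ] ℂ} {q : B →⋆ₐ[ℂ] C}
    (hq : ∀ b, ε' (q b) = ε b) (n : ℕ) :
    (kerPow ε n).map q.toAlgHom.toLinearMap ≤ kerPow ε' n := by
  rw [kerPow, Submodule.map_span_le]
  rintro _ ⟨b, hb, rfl⟩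
  refine Submodule.subset_span ⟨fun i => q (b i), fun i => by rw [hq, hb], ?_⟩
  change q (List.ofFn b).prod = _
  rw [map_list_prod, List.map_ofFn]
  rfl

/-- Any preimage of an element of `ker ε'` lies in `ker ε`, so a product can be lifted factor by
factor. -/
theorem le_kerPow_map {ε : B →⋆ₐ[ℂ] ℂ} {ε' : C →⋆ₐ[ℂ] ℂ} {q : B →⋆ₐ[ℂ] C}
    (hq : ∀ b, ε' (q b) = ε b) (hsurj : Function.Surjective q) (n : ℕ) :
    kerPow ε' n ≤ (kerPow ε n).map q.toAlgHom.toLinearMap := by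
  refine Submodule.span_le.2 ?_
  rintro _ ⟨c, hc, rfl⟩
  choose b hb using fun i => hsurj (c i)
  refine ⟨(List.ofFn b).prod, Submodule.subset_span ⟨b, fun i => by rw [← hq, hb, hc], rfl⟩, ?_⟩
  change q (List.ofFn b).prod = _
  rw [map_list_prod, List.map_ofFn, show (q ∘ b) = c from funext hb]

theorem pullback_mem_iff {ε : B →⋆ₐ[ℂ] ℂ} {ε' : C →⋆ₐ[ℂ] ℂ} {q : B →⋆ₐ[ℂ] C}
    (hq : ∀ b, ε' (q b) = ε b) (hsurj : Function.Surjective q)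
    (p : (C →ₗ[ℂ] ℂ) × (C →ₗ[ℂ] D)) :
    pullback q D p ∈ gaussianPairs ε D ↔ p ∈ gaussianPairs ε' D := by
  have e1 : ∀ b, (pullback q D p).1 b = p.1 (q b) := fun _ => rfl
  have e2 : ∀ b, (pullback q D p).2 b = p.2 (q b) := fun _ => rfl
  constructor
  · rintro ⟨⟨⟨h1, h2, h3⟩, h4⟩, h5, h6⟩
    refine ⟨⟨⟨?_, ?_, ?_⟩, ?_⟩, ?_, ?_⟩
    · simpa [e1] using h1
    · intro c
      obtain ⟨b, rfl⟩ := hsurj c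
      simpa only [e1, map_star] using h2 b
    · intro c hc
      obtain ⟨b, rfl⟩ := hsurj c
      simpa only [e1, map_mul, map_star] using h3 b (by rw [← hq, hc])
    · intro x hx
      obtain ⟨y, hy, rfl⟩ := le_kerPow_map hq hsurj 3 hx
      exact h4 y hy
    · intro c d
      obtain ⟨a, rfl⟩ := hsurj c
      obtain ⟨b, rfl⟩ := hsurj d
      simpa only [e2, map_mul, ← hq] using h5 a b
    · intro c d
      obtain ⟨a, rfl⟩ := hsurj c
      obtain ⟨b, rfl⟩ := hsurj d
      simpa only [coboundary, e1, e2, map_mul, map_star, ← hq] using h6 a b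
  · rintro ⟨⟨⟨h1, h2, h3⟩, h4⟩, h5, h6⟩
    refine ⟨⟨⟨?_, ?_, ?_⟩, ?_⟩, ?_, ?_⟩
    · simpa [e1] using h1
    · intro b
      simpa only [e1, map_star] using h2 (q b)
    · intro b hb
      simpa only [e1, map_mul, map_star] using h3 (q b) (by rw [hq, hb])
    · intro x hx
      exact h4 _ (kerPow_map hq 3 ⟨x, hx, rfl⟩)
    · intro a b
      simpa only [e2, map_mul, hq] using h5 (q a) (q b)
    · intro a b
      simpa only [coboundary, e1, e2, map_mul, map_star, hq] using h6 (q a) (q b)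

/-- A surjection of vector spaces has a linear section `σ`; `f ∘ σ` works because `σ (q b) - b` lies
in the kernel of `q`. -/
theorem exists_comp_eq_of_surjective {V : Type*} [AddCommGroup V] [Module ℂ V]
    {q : B →⋆ₐ[ℂ] C} (hsurj : Function.Surjective q) (f : B →ₗ[ℂ] V)
    (hf : ∀ b, q b = 0 → f b = 0) :
    ∃ g : C →ₗ[ℂ] V, g ∘ₗ q.toAlgHom.toLinearMap = f := by
  obtain ⟨σ, hσ⟩ := q.toAlgHom.toLinearMap.exists_rightInverse_of_surjective
    (LinearMap.range_eq_top.2 hsurj)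
  refine ⟨f ∘ₗ σ, LinearMap.ext fun b => ?_⟩
  have h : q (σ (q b)) = q b := DFunLike.congr_fun hσ (q b)
  have := hf (σ (q b) - b) (by rw [map_sub, h, sub_self])
  rw [map_sub, sub_eq_zero] at this
  exact this

/-- Injectivity is formal; `hker` is exactly what makes pairs descend along `q`. -/
theorem bijOn_pullback {ε : B →⋆ₐ[ℂ] ℂ} {ε' : C →⋆ₐ[ℂ] ℂ} {q : B →⋆ₐ[ℂ] C}
    (hq : ∀ b, ε' (q b) = ε b) (hsurj : Function.Surjective q)
    (hker : ∀ p ∈ gaussianPairs ε D, ∀ b, q b = 0 → p.1 b = 0 ∧ p.2 b = 0) :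
    Set.BijOn (pullback q D) (gaussianPairs ε' D) (gaussianPairs ε D) := by
  refine ⟨fun p hp => (pullback_mem_iff hq hsurj p).2 hp, ?_, ?_⟩
  · rintro ⟨φ, η⟩ - ⟨φ', η'⟩ - h
    have h1 := congrArg Prod.fst h
    have h2 := congrArg Prod.snd h
    refine Prod.ext (LinearMap.ext fun c => ?_) (LinearMap.ext fun c => ?_)
    · obtain ⟨b, rfl⟩ := hsurj c
      exact DFunLike.congr_fun h1 b
    · obtain ⟨b, rfl⟩ := hsurj c
      exact DFunLike.congr_fun h2 b
  · rintro ⟨φ, η⟩ hp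
    obtain ⟨φ', rfl⟩ := exists_comp_eq_of_surjective hsurj φ fun b hb => (hker _ hp b hb).1
    obtain ⟨η', rfl⟩ := exists_comp_eq_of_surjective hsurj η fun b hb => (hker _ hp b hb).2
    exact ⟨(φ', η'), (pullback_mem_iff hq hsurj _).1 hp, rfl⟩

end

/-! ## The correspondence -/

section

variable {r : FreeAlgebra ℂ (Fin N × Fin N) → FreeAlgebra ℂ (Fin N × Fin N) → Prop}
  {T : Matrix (Fin N) (Fin (N - 1)) ℝ}

/-- The relations of `B_N⁺` imply those of the other two algebras, so this check serves all three.
-/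
theorem lift_blockEntry_relB (hT : IsSumZeroFrame T) (hN : 1 ≤ N)
    {a b : FreeAlgebra ℂ (Fin N × Fin N)} (h : RelB N a b) :
    FreeAlgebra.lift ℂ (fun x => blockEntry T x.1 x.2) a =
      FreeAlgebra.lift ℂ (fun x => blockEntry T x.1 x.2) b := by
  have ho := hT.isOrthogonal_inflate hN (isOrthogonal_genMatrix (r := RelO (N - 1)) fun _ _ => id)
  cases h with
  | orth h =>
    cases h with
    | mul_star i j =>
      rw [apply_ite (FreeAlgebra.lift ℂ _)]
      have := congrFun (congrFun ho.mul_transpose i) j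
      simpa [Matrix.mul_apply, Matrix.one_apply, blockEntry_eq_inflate] using this
    | star_mul i j =>
      rw [apply_ite (FreeAlgebra.lift ℂ _)]
      have := congrFun (congrFun ho.transpose_mul i) j
      simpa [Matrix.mul_apply, Matrix.one_apply, blockEntry_eq_inflate] using this
  | row i =>
    have := hT.rowSumsOne_inflate hN (genMatrix (RelO (N - 1))) i
    simpa [blockEntry_eq_inflate] using this
  | col j =>
    have := hT.rowSumsOne_inflate hN (genMatrix (RelO (N - 1)))ᵀ j
    simpa [blockEntry_eq_inflate, ← transpose_inflate] using this

/-- The generators are recovered from the block entries by `w = Tᵗ U T`. -/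
theorem surjective_of_blockEntry (hT : IsSumZeroFrame T)
    {B : Type*} [Ring B] [Algebra ℂ B] (q : B →ₐ[ℂ] PolO (N - 1))
    (hq : ∀ i j, blockEntry T i j ∈ q.range) : Function.Surjective q := by
  rw [← AlgHom.range_eq_top, eq_top_iff]
  have hg : ∀ x, UnivStarAlg.gen (RelO (N - 1)) x ∈ q.range := by
    rintro ⟨k, l⟩
    have h := congrFun (congrFun (hT.compress_inflate (genMatrix (RelO (N - 1)))) k) l
    rw [compress_apply] at h
    rw [show UnivStarAlg.gen (RelO (N - 1)) (k, l) = genMatrix (RelO (N - 1)) k l from rfl, ← h]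
    refine Subalgebra.sum_mem _ fun i _ => Subalgebra.sum_mem _ fun j _ =>
      Subalgebra.smul_mem _ ?_ _
    rw [← blockEntry_eq_inflate]
    exact hq i j
  rintro c -
  obtain ⟨a, rfl⟩ := UnivStarAlg.mk_surjective _ c
  induction a using FreeAlgebra.induction with
  | grade0 c => rw [AlgHom.commutes]; exact Subalgebra.algebraMap_mem _ _
  | grade1 x => exact hg x
  | mul a b ha hb => rw [map_mul]; exact Subalgebra.mul_mem _ ha hb
  | add a b ha hb => rw [map_add]; exact Subalgebra.add_mem _ ha hb

/-- If all row and column sums of an orthogonal matrix agree, then their square is `1`. -/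
theorem sum_mul_self_eq_one {A : Type*} [Ring A] {U : Matrix (Fin N) (Fin N) A}
    (hU : IsOrthogonal U) {s : A} (hr : ∀ i, ∑ k, U i k = s) (hc : ∀ j, ∑ k, U k j = s)
    (i : Fin N) : s * s = 1 := by
  have h : ∑ j, (U * Uᵀ) i j = s * s := by
    simp only [Matrix.mul_apply, Matrix.transpose_apply]
    rw [Finset.sum_comm]
    simp only [← Finset.mul_sum, hc, ← Finset.sum_mul, hr]
  rw [← h, hU.mul_transpose]
  simp [Matrix.one_apply]

/-- Common treatment of the three algebras: orthogonality and equal sums suffice for everything but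
injectivity, which also needs the sums to be `1`. -/
theorem exists_blockHom (hT : IsSumZeroFrame T) (hN : 1 ≤ N)
    (hO : ∀ a b, RelO N a b → r a b)
    (hsum : ∀ i j, ∑ k, UnivStarAlg.gen r (i, k) = ∑ k, UnivStarAlg.gen r (k, j))
    (hr : ∀ a b, r a b → FreeAlgebra.lift ℂ (fun x => blockEntry T x.1 x.2) a =
      FreeAlgebra.lift ℂ (fun x => blockEntry T x.1 x.2) b)
    (ε : UnivStarAlg r →⋆ₐ[ℂ] ℂ) (hε : ∀ x, ε (UnivStarAlg.gen r x) = delta N x) :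
    ∃ q : UnivStarAlg r →⋆ₐ[ℂ] PolO (N - 1),
      (∀ i j, q (UnivStarAlg.gen r (i, j)) = blockEntry T i j) ∧
      (∀ b, counitO (N - 1) (q b) = ε b) ∧
      Function.Surjective q ∧
      ((∀ i, ∑ k, UnivStarAlg.gen r (i, k) = 1) → Function.Injective q) ∧
      ∀ (D : Type u) [NormedAddCommGroup D] [InnerProductSpace ℂ D],
        Set.BijOn (pullback q D) (gaussianPairs (counitO (N - 1)) D) (gaussianPairs ε D) := by
  let q := UnivStarAlg.lift r (fun x => blockEntry T x.1 x.2)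
    (fun x => star_blockEntry T x.1 x.2) hr
  have hgen : ∀ i j, q (UnivStarAlg.gen r (i, j)) = blockEntry T i j := fun i j =>
    UnivStarAlg.lift_gen _ _ _ _ _
  have hcounit : ∀ b, counitO (N - 1) (q b) = ε b := by
    have : (counitO (N - 1)).toAlgHom.comp q.toAlgHom = ε.toAlgHom := by
      refine UnivStarAlg.algHom_ext fun x => ?_
      change counitO (N - 1) (q (UnivStarAlg.gen r (x.1, x.2))) = ε (UnivStarAlg.gen r x)
      rw [hgen, counitO_blockEntry hT hN, hε]
    exact fun b => DFunLike.congr_fun this b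
  have hsurj : Function.Surjective q :=
    surjective_of_blockEntry hT q.toAlgHom fun i j => ⟨_, hgen i j⟩
  have hU := isOrthogonal_genMatrix hO
  -- a homomorphism which maps the row sums to `1` vanishes on the kernel of `q`
  have hfac : ∀ {A : Type} [Ring A] [Algebra ℂ A] (π : UnivStarAlg r →ₐ[ℂ] A),
      (∀ i, π (∑ k, UnivStarAlg.gen r (i, k)) = 1) → ∀ b, q b = 0 → π b = 0 := by
    intro A _ _ π hπ b hb
    obtain ⟨p, hp⟩ := exists_algHom_polO_blockEntry hT hN hU π hπ fun j => by
      have := hπ j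
      rw [hsum j j] at this
      exact this
    have h : p.comp q.toAlgHom = π := UnivStarAlg.algHom_ext fun x => by
      change p (q (UnivStarAlg.gen r (x.1, x.2))) = π (UnivStarAlg.gen r x)
      rw [hgen, hp]; rfl
    rw [← h]
    change p (q b) = 0
    rw [hb, map_zero]
  refine ⟨q, hgen, hcounit, hsurj, fun h1 => ?_, fun D _ _ => ?_⟩
  · rw [injective_iff_map_eq_zero]
    exact fun b hb => hfac (AlgHom.id ℂ _) h1 b hb
  · refine bijOn_pullback hcounit hsurj fun p hp b hb => ?_
    -- Bundling `φ` and `η` lets one ideal serve both.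
    let f : UnivStarAlg r →ₗ[ℂ] ℂ × D := p.1.prod p.2
    have hrow : ∀ i, (coreIdeal f).ringCon.mkₐ (α := ℂ) (∑ k, UnivStarAlg.gen r (i, k)) = 1 := by
      intro i
      rw [← map_one ((coreIdeal f).ringCon.mkₐ (α := ℂ)), ← sub_eq_zero, ← map_sub,
        mk_coreIdeal_eq_zero_iff]
      intro a c
      have hs := sum_mul_self_eq_one hU (s := ∑ k, UnivStarAlg.gen r (i, k))
        (fun i' => (hsum i' i).trans (hsum i i).symm) (fun j => (hsum i j).symm) i
      have := gaussianPairs_vanish hp hs (by simp [hε, delta]) a c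
      exact Prod.ext this.1 this.2
    have h0 := (mk_coreIdeal_eq_zero_iff f b).1 (hfac _ hrow b hb) 1 1
    rw [one_mul, mul_one] at h0
    exact ⟨congrArg Prod.fst h0, congrArg Prod.snd h0⟩

end

end GaussQG

end

/-! ### The three quantum groups. -/

theorem mainTheorem10 (N : ℕ) (hN : 1 ≤ N) :
    (∃ T : Matrix (Fin N) (Fin (N - 1)) ℝ, GaussQG.IsSumZeroFrame T) ∧
    ∀ T : Matrix (Fin N) (Fin (N - 1)) ℝ, GaussQG.IsSumZeroFrame T →
      (∃ q : GaussQG.PolB N →⋆ₐ[ℂ] GaussQG.PolO (N - 1),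
        (∀ i j, q (GaussQG.UnivStarAlg.gen (GaussQG.RelB N) (i, j)) = GaussQG.blockEntry T i j) ∧
        (∀ b, GaussQG.counitO (N - 1) (q b) = GaussQG.counitB N b) ∧
        Function.Bijective q ∧
        ∀ (D : Type u) [NormedAddCommGroup D] [InnerProductSpace ℂ D],
          Set.BijOn (GaussQG.pullback q D)
            (GaussQG.gaussianPairs (GaussQG.counitO (N - 1)) D)
            (GaussQG.gaussianPairs (GaussQG.counitB N) D)) ∧
      (∃ q : GaussQG.PolBPrime N →⋆ₐ[ℂ] GaussQG.PolO (N - 1),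
        (∀ i j, q (GaussQG.UnivStarAlg.gen (GaussQG.RelBPrime N) (i, j)) =
          GaussQG.blockEntry T i j) ∧
        (∀ b, GaussQG.counitO (N - 1) (q b) = GaussQG.counitBPrime N b) ∧
        Function.Surjective q ∧
        ∀ (D : Type u) [NormedAddCommGroup D] [InnerProductSpace ℂ D],
          Set.BijOn (GaussQG.pullback q D)
            (GaussQG.gaussianPairs (GaussQG.counitO (N - 1)) D)
            (GaussQG.gaussianPairs (GaussQG.counitBPrime N) D)) ∧
      (∃ q : GaussQG.PolBSharp N →⋆ₐ[ℂ] GaussQG.PolO (N - 1),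
        (∀ i j, q (GaussQG.UnivStarAlg.gen (GaussQG.RelBSharp N) (i, j)) =
          GaussQG.blockEntry T i j) ∧
        (∀ b, GaussQG.counitO (N - 1) (q b) = GaussQG.counitBSharp N b) ∧
        Function.Surjective q ∧
        ∀ (D : Type u) [NormedAddCommGroup D] [InnerProductSpace ℂ D],
          Set.BijOn (GaussQG.pullback q D)
            (GaussQG.gaussianPairs (GaussQG.counitO (N - 1)) D)
            (GaussQG.gaussianPairs (GaussQG.counitBSharp N) D)) := by
  refine ⟨GaussQG.exists_isSumZeroFrame hN, fun T hT => ⟨?_, ?_, ?_⟩⟩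
  · have hrow : ∀ i, ∑ k, GaussQG.UnivStarAlg.gen (GaussQG.RelB N) (i, k) = 1 := fun i => by
      simpa [GaussQG.UnivStarAlg.gen] using
        GaussQG.UnivStarAlg.mk_eq _ (GaussQG.RelB.row (N := N) i)
    have hcol : ∀ j, ∑ k, GaussQG.UnivStarAlg.gen (GaussQG.RelB N) (k, j) = 1 := fun j => by
      simpa [GaussQG.UnivStarAlg.gen] using
        GaussQG.UnivStarAlg.mk_eq _ (GaussQG.RelB.col (N := N) j)
    obtain ⟨q, h1, h2, h3, h4, h5⟩ := GaussQG.exists_blockHom hT hN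
      (fun _ _ => GaussQG.RelB.orth) (fun i j => (hrow i).trans (hcol j).symm)
      (fun _ _ => GaussQG.lift_blockEntry_relB hT hN) (GaussQG.counitB N)
      (fun _ => GaussQG.UnivStarAlg.lift_gen _ _ _ _ _)
    exact ⟨q, h1, h2, ⟨h4 hrow, h3⟩, h5⟩
  · obtain ⟨q, h1, h2, h3, -, h5⟩ := GaussQG.exists_blockHom (r := GaussQG.RelBPrime N) hT hN
      (fun _ _ => GaussQG.RelBPrime.orth)
      (fun i j => by
        simpa [GaussQG.UnivStarAlg.gen] using
          GaussQG.UnivStarAlg.mk_eq _ (GaussQG.RelBPrime.sums i j))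
      (fun a b h => by
        cases h with
        | orth h => exact GaussQG.lift_blockEntry_relB hT hN (.orth h)
        | sums i j =>
          exact (GaussQG.lift_blockEntry_relB hT hN (.row i)).trans
            (GaussQG.lift_blockEntry_relB hT hN (.col j)).symm
        | central i j l =>
          -- The row sums of the block matrix are `1`, so they are central.
          rw [map_mul, map_mul, GaussQG.lift_blockEntry_relB hT hN (.row l), map_one, mul_one,
            one_mul])
      (GaussQG.counitBPrime N) (fun _ => GaussQG.UnivStarAlg.lift_gen _ _ _ _ _)
    exact ⟨q, h1, h2, h3, h5⟩
  · obtain ⟨q, h1, h2, h3, -, h5⟩ := GaussQG.exists_blockHom (r := GaussQG.RelBSharp N) hT hN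
      (fun _ _ => GaussQG.RelBSharp.orth)
      (fun i j => by
        simpa [GaussQG.UnivStarAlg.gen] using
          GaussQG.UnivStarAlg.mk_eq _ (GaussQG.RelBSharp.sums i j))
      (fun a b h => by
        cases h with
        | orth h => exact GaussQG.lift_blockEntry_relB hT hN (.orth h)
        | sums i j =>
          exact (GaussQG.lift_blockEntry_relB hT hN (.row i)).trans
            (GaussQG.lift_blockEntry_relB hT hN (.col j)).symm)
      (GaussQG.counitBSharp N) (fun _ => GaussQG.UnivStarAlg.lift_gen _ _ _ _ _)
    exact ⟨q, h1, h2, h3, h5⟩
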